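/- Let $n\ge 3$ and $M\ge 3$. Write $\Delta_n=\{x\in\mathbb R^n: x_i\ge 0,\ \sum_i x_i=1\}$, let $e_1,\dots,e_n$ be its vertices, $\widetilde\Delta_n=\Delta_n\setminus\{e_1,\dots,e_n\}$ and $\mathrm{int}(\Delta_n)=\{x\in\Delta_n: x_i>0 \text{ for all } i\}$. Let $C_1,\dots,C_M\in\mathbb R^{n\times n}$ be relative interaction matrices, that is, row-stochastic matrices with zero diagonal, and suppose that each $C_p$ is irreducible and that the digraph of each $C_p$ (with an edge from $j$ to $i$ whenever $(C_p)_{ij}>0$) does not have star topology, i.e. no single node is an endpoint of every edge. Let $c_p=(c_{1,p},\dots,c_{n,p})$ be the dominant left eigenvector of $C_p$, i.e. the unique vector with $c_p^\top C_p=c_p^\top$ and $\sum_i c_{i,p}=1$. Put $$\alpha_p(x)=\Big(\sum_{i=1}^n\frac{c_{i,p}}{1-x_i}\Big)^{-1},\qquad F_p(x)=\begin{cases}e_i & \text{if } x=e_i \text{ for some } i,\\ \alpha_p(x)\big(\tfrac{c_{1,p}}{1-x_1},\dots,\tfrac{c_{n,p}}{1-x_n}\big)^\top&\text{otherwise,}\end{cases}$$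 and, with indices read cyclically modulo $M$, let $G_p=F_{p+M-1}\circ\cdots\circ F_{p+1}\circ F_p$, that is, $G_p=F_{p-1}\circ\cdots\circ F_1\circ F_M\circ\cdots\circ F_p$. Then for every $p\in\{1,\dots,M\}$ the following hold. (P1) If $y\in\widetilde\Delta_n$, then for every $k\in\{0,\dots,M-1\}$ the point $y^{(k)}=F_{p+k-1}\circ\cdots\circ F_p(y)$ (with $y^{(0)}=y$) lies in $\widetilde\Delta_n$, so that the normaliser $\alpha_{p+k}$ is evaluated at a point with all $y^{(k)}_i<1$, and $\alpha_{p+k}(y^{(k)})>0$. (P2) $G_p(e_i)=e_i$ for every $i\in\{1,\dots,n\}$. (P3) $G_p$ maps $\Delta_n$ into $\Delta_n$ and is continuous on $\Delta_n$. (P4) $G_p$ has at least one fixed point in $\mathrm{int}(\Delta_n)$. -/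

import Mathlib

open Matrix

noncomputable section

namespace DeGrootFriedkin

/-- A relative interaction matrix: entrywise nonnegative, row sums equal to `1`, zero diagonal. -/
structure IsRelativeInteraction {n : ℕ} (C : Matrix (Fin n) (Fin n) ℝ) : Prop where
  rowStochastic : C ∈ Matrix.rowStochastic ℝ (Fin n)
  diag_zero : ∀ i, C i i = 0

/-- The digraph of `C` (an edge between `j` and `i` for each `C i j > 0`) has star topology: some
node `k` is an endpoint of every edge. -/
def HasStarTopology {n : ℕ} (C : Matrix (Fin n) (Fin n) ℝ) : Prop :=
  ∃ k, ∀ i j, 0 < C i j → i = k ∨ j = k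

/-- `c` is a left eigenvector of `C` for the eigenvalue `1`, normalised to have entry sum `1`. -/
def IsDominantLeftEigenvector {n : ℕ} (C : Matrix (Fin n) (Fin n) ℝ) (c : Fin n → ℝ) : Prop :=
  c ᵥ* C = c ∧ ∑ i, c i = 1

/-- The dominant left eigenvector of `C`. It is uniquely determined when `C` is row-stochastic and
irreducible, see `existsUnique_isDominantLeftEigenvector`. -/
def dominantLeftEigenvector {n : ℕ} (C : Matrix (Fin n) (Fin n) ℝ) : Fin n → ℝ :=
  Classical.epsilon (IsDominantLeftEigenvector C)

theorem eigen_pos {n : ℕ} {C : Matrix (Fin n) (Fin n) ℝ} (hirr : C.IsIrreducible)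
    {v : Fin n → ℝ} (hv : v ᵥ* C = v) (h0 : ∀ i, 0 ≤ v i) {i : Fin n} (hi : v i ≠ 0)
    (j : Fin n) : 0 < v j := by
  obtain ⟨k, -, hk⟩ := (Matrix.isIrreducible_iff_exists_pow_pos hirr.nonneg).1 hirr i j
  have hpow : ∀ m : ℕ, v ᵥ* C ^ m = v := by
    intro m
    induction m with
    | zero => simp
    | succ m ih => rw [pow_succ, ← Matrix.vecMul_vecMul, ih, hv]
  have h := congrFun (hpow k) j
  rw [← h]
  simp only [Matrix.vecMul, dotProduct]
  have hi' : 0 < v i := lt_of_le_of_ne (h0 i) (Ne.symm hi)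
  exact Finset.sum_pos' (fun l _ => mul_nonneg (h0 l) (Matrix.pow_apply_nonneg hirr.nonneg k l j))
    ⟨i, Finset.mem_univ i, mul_pos hi' hk⟩

theorem abs_eigen {n : ℕ} {C : Matrix (Fin n) (Fin n) ℝ}
    (hC : C ∈ Matrix.rowStochastic ℝ (Fin n)) {v : Fin n → ℝ} (hv : v ᵥ* C = v) :
    (fun i => |v i|) ᵥ* C = fun i => |v i| := by
  obtain ⟨hn, h1⟩ := Matrix.mem_rowStochastic.1 hC
  have hle : ∀ j ∈ (Finset.univ : Finset (Fin n)), |v j| ≤ ((fun i => |v i|) ᵥ* C) j := by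
    intro j _
    have h := congrFun hv j
    simp only [Matrix.vecMul, dotProduct] at h ⊢
    calc |v j| = |∑ i, v i * C i j| := by rw [h]
      _ ≤ ∑ i, |v i * C i j| := Finset.abs_sum_le_sum_abs _ _
      _ = ∑ i, |v i| * C i j := by simp [abs_mul, abs_of_nonneg (hn _ _)]
  have hsum : ∑ j, |v j| = ∑ j, ((fun i => |v i|) ᵥ* C) j := by
    simp only [Matrix.vecMul, dotProduct]
    rw [Finset.sum_comm]
    refine Finset.sum_congr rfl fun i _ => ?_
    have h := congrFun h1 i
    simp only [Matrix.mulVec, dotProduct, Pi.one_apply, mul_one] at h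
    rw [← Finset.mul_sum, h, mul_one]
  funext j
  exact ((Finset.sum_eq_sum_iff_of_le hle).1 hsum j (Finset.mem_univ j)).symm

theorem existsUnique_isDominantLeftEigenvector {n : ℕ} (hn : 1 ≤ n)
    {C : Matrix (Fin n) (Fin n) ℝ} (hC : C ∈ Matrix.rowStochastic ℝ (Fin n))
    (hirr : C.IsIrreducible) : ∃! c, IsDominantLeftEigenvector C c := by
  have i0 : Fin n := ⟨0, hn⟩
  obtain ⟨v, hv0, hv⟩ : ∃ v, v ≠ 0 ∧ v ᵥ* (C - 1) = 0 := by
    rw [Matrix.exists_vecMul_eq_zero_iff, ← Matrix.exists_mulVec_eq_zero_iff]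
    refine ⟨1, fun h => one_ne_zero (congrFun h i0), ?_⟩
    rw [Matrix.sub_mulVec, (Matrix.mem_rowStochastic.1 hC).2, Matrix.one_mulVec, sub_self]
  rw [Matrix.vecMul_sub, Matrix.vecMul_one, sub_eq_zero] at hv
  have ha := abs_eigen hC hv
  obtain ⟨i, hi⟩ := Function.ne_iff.1 hv0
  have hpos := eigen_pos hirr ha (fun i => abs_nonneg _) (i := i) (abs_ne_zero.2 hi)
  have hS : 0 < ∑ i, |v i| := Finset.sum_pos (fun j _ => hpos j) ⟨i0, Finset.mem_univ _⟩
  refine ⟨(∑ i, |v i|)⁻¹ • fun i => |v i|, ⟨?_, ?_⟩, ?_⟩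
  · rw [Matrix.smul_vecMul, ha]
  · simp only [Pi.smul_apply, smul_eq_mul, ← Finset.mul_sum]
    exact inv_mul_cancel₀ hS.ne'
  · suffices huniq : ∀ a b, IsDominantLeftEigenvector C a → IsDominantLeftEigenvector C b →
        ∀ i, a i ≤ b i by
      intro y hy
      have hz : IsDominantLeftEigenvector C ((∑ i, |v i|)⁻¹ • fun i => |v i|) := by
        refine ⟨by rw [Matrix.smul_vecMul, ha], ?_⟩
        simp only [Pi.smul_apply, smul_eq_mul, ← Finset.mul_sum]
        exact inv_mul_cancel₀ hS.ne'
      exact funext fun i => le_antisymm (huniq _ _ hy hz i) (huniq _ _ hz hy i)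
    intro a b hA hB i
    by_contra! hlt
    have hw : (a - b) ᵥ* C = a - b := by rw [Matrix.sub_vecMul, hA.1, hB.1]
    have hw' := abs_eigen hC hw
    have hd : ((fun i => |(a - b) i|) - (a - b)) ᵥ* C = (fun i => |(a - b) i|) - (a - b) := by
      rw [Matrix.sub_vecMul, hw', hw]
    have hdi : ((fun i => |(a - b) i|) - (a - b)) i = 0 := by
      simp only [Pi.sub_apply]
      rw [abs_of_pos (sub_pos.2 hlt), sub_self]
    have hall : ∀ j, 0 ≤ (a - b) j := by
      intro j
      by_contra! hj
      have h := eigen_pos hirr hd (fun l => sub_nonneg.2 (le_abs_self _)) (i := j)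
        (by simp only [Pi.sub_apply] at hj ⊢; rw [abs_of_neg hj]; linarith) i
      exact h.ne' hdi
    have hs : ∑ j, (a - b) j = 0 := by
      simp only [Pi.sub_apply, Finset.sum_sub_distrib, hA.2, hB.2, sub_self]
    have h := (Finset.sum_eq_zero_iff_of_nonneg (fun j _ => hall j)).1 hs i (Finset.mem_univ i)
    simp only [Pi.sub_apply] at h
    linarith

/-- The simplex `Δ_n` without its vertices `e_1, …, e_n`. -/
def simplexMinusVertices (n : ℕ) : Set (Fin n → ℝ) :=
  stdSimplex ℝ (Fin n) \ Set.range fun i => Pi.single i 1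

/-- The relative interior of `Δ_n`: points of the simplex with all coordinates positive. -/
def simplexInterior (n : ℕ) : Set (Fin n → ℝ) :=
  {x | (∀ i, 0 < x i) ∧ ∑ i, x i = 1}

/-- The normaliser `α(x) = 1 / ∑ i, c i / (1 - x i)`, where `c` is the dominant left eigenvector
of `C`. -/
def normaliser {n : ℕ} (C : Matrix (Fin n) (Fin n) ℝ) (x : Fin n → ℝ) : ℝ :=
  1 / ∑ i, dominantLeftEigenvector C i / (1 - x i)

open Classical in
/-- The DeGroot–Friedkin map of `C`: it sends each vertex `e_i` to itself, and any other `x` to the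
vector with entries `α(x) * (c i / (1 - x i))`. -/
def dfMap {n : ℕ} (C : Matrix (Fin n) (Fin n) ℝ) (x : Fin n → ℝ) : Fin n → ℝ :=
  if x ∈ Set.range (fun i : Fin n => (Pi.single i 1 : Fin n → ℝ)) then x
  else fun i => normaliser C x * (dominantLeftEigenvector C i / (1 - x i))

/-- The index reached from `p` after `k` steps of the cycle `1 → 2 → ⋯ → M → 1`. -/
def cyclicIndex {M : ℕ} (p : Fin M) (k : ℕ) : Fin M :=
  ⟨(p.val + k) % M, Nat.mod_lt _ p.pos⟩

/-- The composition `F_{p+k-1} ∘ ⋯ ∘ F_{p+1} ∘ F_p` of `k` maps, indices taken cyclically. -/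
def partialComp {n M : ℕ} (C : Fin M → Matrix (Fin n) (Fin n) ℝ) (p : Fin M) :
    ℕ → (Fin n → ℝ) → (Fin n → ℝ)
  | 0 => id
  | k + 1 => dfMap (C (cyclicIndex p k)) ∘ partialComp C p k

/-- The full cyclic composition `G_p = F_{p-1} ∘ ⋯ ∘ F_1 ∘ F_M ∘ ⋯ ∘ F_p`. -/
def cyclicComp {n M : ℕ} (C : Fin M → Matrix (Fin n) (Fin n) ℝ) (p : Fin M) :
    (Fin n → ℝ) → (Fin n → ℝ) :=
  partialComp C p M

end DeGrootFriedkin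

end

/-!
# Fixed points of cyclic compositions of DeGroot–Friedkin maps

For a nonvertex `x` the point `F x` is proportional to the positive weights `c i / (1 - x i)`, so
it lies in the interior of the simplex. Near a vertex `e_j`, multiplying all weights by `1 - x j`
gives a quotient that is continuous at `e_j` and takes the value `e_j` there
(`dfMap_eq_vertexWeight`); hence `F` is continuous on the whole simplex.

The fixed point needs no topological fixed point theorem, because every `F` is a strict contraction
for the metric `d(x, y) = ∑ i, |log (1 - x i) - log (1 - y i)|` on the simplex without its vertices
(`logDist_dfMap_lt`). In the coordinates `-log (1 - x i)`, the map is a shift by `log c i`, followed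
by `log a ↦ -log (1 - a i / ∑ a)`, which is defined for every positive vector `a`. As `ℓ¹` distances
add up along coordinate directions, it is enough to change one `a j` at a time
(`sum_abs_negLogCompl_update_lt`). With `S = ∑ a`, raising `S` by raising `a j` alone contracts
distances exactly when `∏ i ≠ j, (1 - a i / S)` divided by `1 - (∑ i ≠ j, a i) / S` strictly
decreases in `S`. Adding the factors one by one reduces this to
`(1 - B / S) (1 - a / S) / (1 - (B + a) / S) = 1 + a B / (S (S - B - a))`.
Two indices other than `j` are needed for strictness, which is where `3 ≤ n` is used.

A digraph without star topology forces `c i < 1 / 2` (`dominantLeftEigenvector_lt_one_sub`), and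
then all the maps preserve one compact set `{x | ∀ i, x i ≤ 1 - r}` with `0 < r`. On it the
continuous function `d(x, G x)` attains its minimum, which strict contraction forces to be at a
fixed point of `G`.
-/

namespace DeGrootFriedkin

open Finset

/-! ### Monotonicity of a product against its linear part -/

/-- Exponentiated, the two sides are the values at `S'` and `S` of
`(1 - a / S) (1 - B / S) / (1 - (B + a) / S) = 1 + a B / (S (S - B - a))`. -/
theorem logGap_insert_lt {a B S S' : ℝ} (ha : 0 < a) (hB : 0 < B) (hS : B + a < S)
    (hSS' : S < S') :
    (Real.log (S' - a) - Real.log S') - (Real.log (S' - (B + a)) - Real.log (S' - B)) <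
      (Real.log (S - a) - Real.log S) - (Real.log (S - (B + a)) - Real.log (S - B)) := by
  have key : (S' - a) * (S' - B) * (S * (S - (B + a))) <
      (S - a) * (S - B) * (S' * (S' - (B + a))) := by
    have h1 : S * (S - (B + a)) < S' * (S' - (B + a)) :=
      mul_lt_mul'' hSS' (by linarith) (by linarith) (by linarith)
    have h2 := mul_lt_mul_of_pos_left h1 (mul_pos ha hB)
    linear_combination h2
  have h := Real.log_lt_log (mul_pos (mul_pos (by linarith) (by linarith))
    (mul_pos (by linarith) (by linarith))) key
  rw [Real.log_mul (mul_ne_zero (by linarith) (by linarith))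
      (mul_ne_zero (by linarith) (by linarith)),
    Real.log_mul (by linarith) (by linarith), Real.log_mul (by linarith) (by linarith),
    Real.log_mul (mul_ne_zero (by linarith) (by linarith))
      (mul_ne_zero (by linarith) (by linarith)),
    Real.log_mul (by linarith) (by linarith), Real.log_mul (by linarith) (by linarith)] at h
  linarith

/-- The logarithm of `∏ i ∈ s, (1 - a i / S)` divided by `1 - (∑ i ∈ s, a i) / S`, for positive `a`
and `∑ i ∈ s, a i < S`. -/
noncomputable def logGap {ι : Type*} (a : ι → ℝ) (s : Finset ι) (S : ℝ) : ℝ :=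
  ∑ i ∈ s, (Real.log (S - a i) - Real.log S) - (Real.log (S - ∑ i ∈ s, a i) - Real.log S)

theorem logGap_insert {ι : Type*} [DecidableEq ι] (a : ι → ℝ) {s : Finset ι} {i : ι}
    (hi : i ∉ s) (S : ℝ) :
    logGap a (insert i s) S = logGap a s S + ((Real.log (S - a i) - Real.log S) -
      (Real.log (S - (∑ k ∈ s, a k + a i)) - Real.log (S - ∑ k ∈ s, a k))) := by
  simp only [logGap, sum_insert hi, add_comm (a i)]
  ring

theorem logGap_antitone {ι : Type*} {a : ι → ℝ} (ha : ∀ i, 0 < a i) (s : Finset ι)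
    {S S' : ℝ} (hS : ∑ i ∈ s, a i < S) (hSS' : S < S') : logGap a s S' ≤ logGap a s S := by
  classical
  induction s using Finset.induction with
  | empty => simp [logGap]
  | insert i s hi ih =>
    rw [sum_insert hi] at hS
    have h0 : 0 < a i := ha i
    rw [logGap_insert a hi, logGap_insert a hi]
    refine add_le_add (ih (by linarith)) ?_
    rcases s.eq_empty_or_nonempty with rfl | hs
    · simp
    · exact (logGap_insert_lt h0 (sum_pos (fun k _ => ha k) hs) (by linarith) hSS').le

/-- With a single factor `logGap` is identically zero, so two are needed for strictness. -/
theorem logGap_lt {ι : Type*} {a : ι → ℝ} (ha : ∀ i, 0 < a i) {s : Finset ι}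
    (hs : 1 < s.card) {S S' : ℝ} (hS : ∑ i ∈ s, a i < S) (hSS' : S < S') :
    logGap a s S' < logGap a s S := by
  classical
  obtain ⟨i, hi⟩ : s.Nonempty := card_pos.1 (by omega)
  have hne : (s.erase i).Nonempty := by
    rw [← card_pos, card_erase_of_mem hi]; omega
  have hsum := sum_erase_add s a hi
  have h0 : 0 < a i := ha i
  rw [← insert_erase hi, logGap_insert a (notMem_erase i s), logGap_insert a (notMem_erase i s)]
  exact add_lt_add_of_le_of_lt (logGap_antitone ha _ (by linarith) hSS')
    (logGap_insert_lt h0 (sum_pos (fun k _ => ha k) hne) (by linarith) hSS')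

/-! ### Strict contraction in `ℓ¹` for positive vectors -/

section Contraction

variable {ι : Type*} [Fintype ι]

/-- `-log (1 - y i)`, where `y` is the probability vector proportional to `a`. -/
noncomputable def negLogCompl (a : ι → ℝ) (i : ι) : ℝ :=
  Real.log (∑ k, a k) - Real.log (∑ k, a k - a i)

/-- Raising `a j` raises entry `j` of `negLogCompl a` and lowers all the others, so that the total
change is a difference of two values of `logGap`. -/
theorem sum_abs_negLogCompl_update_lt [DecidableEq ι] (hι : 3 ≤ Fintype.card ι) {a : ι → ℝ}
    (ha : ∀ i, 0 < a i) (j : ι) {t : ℝ} (ht : a j < t) :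
    ∑ i, |negLogCompl a i - negLogCompl (Function.update a j t) i| <
      Real.log t - Real.log (a j) := by
  set b := Function.update a j t with hb
  set s := (univ : Finset ι).erase j with hs
  have hcard : 1 < s.card := by
    rw [hs, card_erase_of_mem (mem_univ j), card_univ]; omega
  set B := ∑ k ∈ s, a k with hB
  have hSa : ∑ k, a k = B + a j := (sum_erase_add univ a (mem_univ j)).symm
  have hne : ∀ i ∈ s, b i = a i := fun i hi => by
    rw [hb, Function.update_of_ne (ne_of_mem_erase hi)]
  have hSb : ∑ k, b k = B + t := by
    rw [← sum_erase_add univ b (mem_univ j), sum_congr rfl hne, hb, Function.update_self]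
  have hj := ha j
  have hle : ∀ i ∈ s, a i ≤ B := fun i hi => single_le_sum (fun k _ => (ha k).le) hi
  have hBpos : 0 < B := sum_pos (fun k _ => ha k) (card_pos.1 (by omega))
  have hterm : ∀ i ∈ s, |negLogCompl a i - negLogCompl b i| =
      (Real.log (B + t - a i) - Real.log (B + t)) -
        (Real.log (B + a j - a i) - Real.log (B + a j)) := by
    intro i hi
    have hi1 := hle i hi
    have hi0 := ha i
    simp only [negLogCompl, hSa, hSb, hne i hi]
    rw [abs_of_nonneg]
    · ring
    · have h := Real.log_le_log (x := (B + a j - a i) * (B + t)) (y := (B + t - a i) * (B + a j))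
        (mul_pos (by linarith) (by linarith)) (by nlinarith)
      rw [Real.log_mul (by linarith) (by linarith), Real.log_mul (by linarith) (by linarith)] at h
      linarith
  have hjterm : |negLogCompl a j - negLogCompl b j| = Real.log (B + t) - Real.log (B + a j) := by
    have hbj : b j = t := by rw [hb, Function.update_self]
    simp only [negLogCompl, hSa, hSb, hbj, add_sub_cancel_right]
    rw [abs_of_nonpos]
    · ring
    · linarith [Real.log_le_log (x := B + a j) (y := B + t) (by linarith) (by linarith)]
  rw [← sum_erase_add univ _ (mem_univ j), hjterm, sum_congr rfl hterm, sum_sub_distrib]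
  have h := logGap_lt ha hcard (S := B + a j) (S' := B + t) (by linarith) (by linarith)
  simp only [logGap, ← hB, add_sub_cancel_left] at h
  linarith

theorem sum_abs_negLogCompl_update_lt_abs [DecidableEq ι] (hι : 3 ≤ Fintype.card ι) {a : ι → ℝ}
    (ha : ∀ i, 0 < a i) (j : ι) {t : ℝ} (ht0 : 0 < t) (ht : a j ≠ t) :
    ∑ i, |negLogCompl a i - negLogCompl (Function.update a j t) i| <
      |Real.log (a j) - Real.log t| := by
  rcases ht.lt_or_gt with h | h
  · refine (sum_abs_negLogCompl_update_lt hι ha j h).trans_le ?_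
    rw [abs_sub_comm]
    exact le_abs_self _
  · have hb : ∀ i, 0 < Function.update a j t i := fun i => by
      rcases eq_or_ne i j with rfl | hi
      · simpa using ht0
      · simpa [hi] using ha i
    have h2 := sum_abs_negLogCompl_update_lt hι hb j (t := a j) (by simpa using h)
    simp only [Function.update_idem, Function.update_eq_self, Function.update_self] at h2
    simp only [abs_sub_comm (negLogCompl a _)]
    exact h2.trans_le (le_abs_self _)

theorem sum_abs_negLogCompl_piecewise_le [DecidableEq ι] (hι : 3 ≤ Fintype.card ι) {a b : ι → ℝ}
    (ha : ∀ i, 0 < a i) (hb : ∀ i, 0 < b i) (s : Finset ι) :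
    ∑ i, |negLogCompl a i - negLogCompl (s.piecewise b a) i| ≤
      ∑ i ∈ s, |Real.log (a i) - Real.log (b i)| := by
  induction s using Finset.induction with
  | empty => simp
  | insert j s hj ih =>
    rw [sum_insert hj, add_comm, piecewise_insert]
    have hpos : ∀ i, 0 < s.piecewise b a i := fun i => by
      by_cases hi : i ∈ s
      · simpa [hi] using hb i
      · simpa [hi] using ha i
    have hval : s.piecewise b a j = a j := piecewise_eq_of_notMem _ _ _ hj
    have hstep : ∑ i, |negLogCompl (s.piecewise b a) i -
        negLogCompl (Function.update (s.piecewise b a) j (b j)) i| ≤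
          |Real.log (a j) - Real.log (b j)| := by
      by_cases h : a j = b j
      · rw [← h, ← hval, Function.update_eq_self]
        simp
      · rw [← hval]
        exact (sum_abs_negLogCompl_update_lt_abs hι hpos j (hb j) (by rwa [hval])).le
    refine le_trans ?_ (add_le_add ih hstep)
    rw [← sum_add_distrib]
    exact sum_le_sum fun i _ => abs_sub_le _ _ _

/-- The map `log a ↦ -log (1 - y)`, with `y = a / ∑ a`, strictly decreases `ℓ¹` distances. The
coordinates of `a` are changed into those of `b` one at a time, which costs nothing in `ℓ¹`. -/
theorem sum_abs_negLogCompl_lt (hι : 3 ≤ Fintype.card ι) {a b : ι → ℝ}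
    (ha : ∀ i, 0 < a i) (hb : ∀ i, 0 < b i) (hab : a ≠ b) :
    ∑ i, |negLogCompl a i - negLogCompl b i| < ∑ i, |Real.log (a i) - Real.log (b i)| := by
  classical
  obtain ⟨j, hj⟩ := Function.ne_iff.1 hab
  have h1 := sum_abs_negLogCompl_update_lt_abs hι ha j (hb j) hj
  have hpos : ∀ i, 0 < Function.update a j (b j) i := fun i => by
    rcases eq_or_ne i j with rfl | hi
    · simpa using hb i
    · simpa [hi] using ha i
  have h2 := sum_abs_negLogCompl_piecewise_le hι hpos hb univ
  have hrest : ∑ i, |Real.log (Function.update a j (b j) i) - Real.log (b i)| =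
      ∑ i ∈ univ.erase j, |Real.log (a i) - Real.log (b i)| := by
    rw [← sum_erase_add univ _ (mem_univ j), Function.update_self, sub_self, abs_zero, add_zero]
    exact sum_congr rfl fun i hi => by rw [Function.update_of_ne (ne_of_mem_erase hi)]
  rw [piecewise_univ, hrest] at h2
  calc ∑ i, |negLogCompl a i - negLogCompl b i|
      ≤ ∑ i, (|negLogCompl a i - negLogCompl (Function.update a j (b j)) i| +
          |negLogCompl (Function.update a j (b j)) i - negLogCompl b i|) :=
        sum_le_sum fun i _ => abs_sub_le _ _ _
    _ < |Real.log (a j) - Real.log (b j)| +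
          ∑ i ∈ univ.erase j, |Real.log (a i) - Real.log (b i)| := by
        rw [sum_add_distrib]
        exact add_lt_add_of_lt_of_le h1 h2
    _ = ∑ i, |Real.log (a i) - Real.log (b i)| := by
        rw [add_comm, sum_erase_add _ _ (mem_univ j)]

end Contraction

/-! ### The truncated simplex and the logarithmic distance -/

section Simplex

variable {n : ℕ}

theorem lt_one_of_mem_simplexMinusVertices {x : Fin n → ℝ} (hx : x ∈ simplexMinusVertices n)
    (i : Fin n) : x i < 1 := by
  obtain ⟨⟨h0, h1⟩, hv⟩ := hx
  refine lt_of_le_of_ne (h1 ▸ single_le_sum (fun k _ => h0 k) (mem_univ i)) fun hi => hv ⟨i, ?_⟩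
  have hs := sum_erase_add univ x (mem_univ i)
  rw [h1, hi, add_eq_right, sum_eq_zero_iff_of_nonneg fun k _ => h0 k] at hs
  funext k
  rcases eq_or_ne k i with rfl | hk
  · simp [hi]
  · simp [hk, hs k (mem_erase.2 ⟨hk, mem_univ k⟩)]

theorem simplexInterior_subset (hn : 2 ≤ n) : simplexInterior n ⊆ simplexMinusVertices n := by
  rintro x ⟨h0, h1⟩
  refine ⟨⟨fun i => (h0 i).le, h1⟩, ?_⟩
  rintro ⟨i, rfl⟩
  have : Nontrivial (Fin n) := Fin.nontrivial_iff_two_le.2 hn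
  obtain ⟨k, hk⟩ := exists_ne i
  simpa [hk] using h0 k

/-- The part of the simplex where every coordinate is at most `1 - r`. -/
def truncatedSimplex (n : ℕ) (r : ℝ) : Set (Fin n → ℝ) :=
  {x ∈ stdSimplex ℝ (Fin n) | ∀ i, x i ≤ 1 - r}

theorem truncatedSimplex_subset {r : ℝ} (hr : 0 < r) :
    truncatedSimplex n r ⊆ simplexMinusVertices n := by
  rintro x ⟨hx, hxr⟩
  refine ⟨hx, ?_⟩
  rintro ⟨i, rfl⟩
  have := hxr i
  simp only [Pi.single_eq_same] at this
  linarith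

theorem isCompact_truncatedSimplex (n : ℕ) (r : ℝ) : IsCompact (truncatedSimplex n r) := by
  refine (isCompact_stdSimplex ℝ (Fin n)).inter_right (t := {x | x ≤ fun _ => 1 - r}) ?_
  exact isClosed_le continuous_id continuous_const

theorem truncatedSimplex_nonempty (hn : 2 ≤ n) {r : ℝ} (hr : r ≤ 1 / 2) :
    (truncatedSimplex n r).Nonempty := by
  have hn' : (2 : ℝ) ≤ n := by exact_mod_cast hn
  refine ⟨fun _ => (n : ℝ)⁻¹, ⟨fun _ => by positivity, ?_⟩, fun _ => ?_⟩
  · simp [mul_inv_cancel₀ (show (n : ℝ) ≠ 0 by linarith)]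
  · have := inv_anti₀ (by norm_num) hn'
    norm_num at *
    linarith

/-- The `ℓ¹` distance in the coordinates `log (1 - x i)`. -/
noncomputable def logDist (x y : Fin n → ℝ) : ℝ := ∑ i, |Real.log (1 - x i) - Real.log (1 - y i)|

theorem logDist_self (x : Fin n → ℝ) : logDist x x = 0 := by simp [logDist]

theorem logDist_nonneg (x y : Fin n → ℝ) : 0 ≤ logDist x y := sum_nonneg fun _ _ => abs_nonneg _

theorem continuousOn_logDist {X : Type*} [TopologicalSpace X] {s : Set X} {f g : X → Fin n → ℝ}
    (hf : ContinuousOn f s) (hg : ContinuousOn g s) (hf1 : ∀ x ∈ s, ∀ i, f x i < 1)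
    (hg1 : ∀ x ∈ s, ∀ i, g x i < 1) : ContinuousOn (fun x => logDist (f x) (g x)) s := by
  unfold logDist
  refine continuousOn_finsetSum _ fun i _ => ContinuousOn.abs (ContinuousOn.sub ?_ ?_)
  · exact (continuousOn_const.sub (continuousOn_pi.1 hf i)).log
      fun x hx => (sub_pos.2 (hf1 x hx i)).ne'
  · exact (continuousOn_const.sub (continuousOn_pi.1 hg i)).log
      fun x hx => (sub_pos.2 (hg1 x hx i)).ne'

end Simplex

/-! ### The dominant left eigenvector and a single map -/

section DFMap

variable {n : ℕ} {C : Matrix (Fin n) (Fin n) ℝ}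

theorem isDominantLeftEigenvector_dominantLeftEigenvector (hn : 1 ≤ n)
    (hC : IsRelativeInteraction C) (hirr : C.IsIrreducible) :
    IsDominantLeftEigenvector C (dominantLeftEigenvector C) :=
  Classical.epsilon_spec (existsUnique_isDominantLeftEigenvector hn hC.rowStochastic hirr).exists

theorem dominantLeftEigenvector_pos (hn : 1 ≤ n) (hC : IsRelativeInteraction C)
    (hirr : C.IsIrreducible) (i : Fin n) : 0 < dominantLeftEigenvector C i := by
  obtain ⟨hv, hs⟩ := isDominantLeftEigenvector_dominantLeftEigenvector hn hC hirr
  set c := dominantLeftEigenvector C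
  have hpos : ∀ i, 0 < |c i| := by
    obtain ⟨k, -, hk⟩ := exists_ne_zero_of_sum_ne_zero (hs.trans_ne one_ne_zero)
    exact eigen_pos hirr (abs_eigen hC.rowStochastic hv) (fun _ => abs_nonneg _)
      (abs_ne_zero.2 hk)
  -- `|c| - c` is a nonnegative eigenvector, so it vanishes identically or nowhere.
  by_contra! hi
  have hd : ((fun i => |c i|) - c) ᵥ* C = (fun i => |c i|) - c := by
    rw [Matrix.sub_vecMul, abs_eigen hC.rowStochastic hv, hv]
  have hneg : ∀ j, 0 < ((fun i => |c i|) - c) j :=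
    eigen_pos hirr hd (fun l => sub_nonneg.2 (le_abs_self _)) (i := i)
      (by have := hpos i; simp only [Pi.sub_apply]; linarith)
  have hle : ∑ j, c j ≤ 0 := sum_nonpos fun j _ => by
    by_contra! h
    have := hneg j
    simp only [Pi.sub_apply, abs_of_pos h, sub_self, lt_irrefl] at this
  linarith

/-- If `c i = ∑ j, c j * C j i` were at least `∑ j ≠ i, c j`, every row `j ≠ i` of `C` would have
all its mass at `i`, which is a star centred at `i`. -/
theorem dominantLeftEigenvector_lt_one_sub (hn : 1 ≤ n) (hC : IsRelativeInteraction C)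
    (hirr : C.IsIrreducible) (hstar : ¬ HasStarTopology C) (i : Fin n) :
    dominantLeftEigenvector C i < 1 - dominantLeftEigenvector C i := by
  obtain ⟨hv, hs⟩ := isDominantLeftEigenvector_dominantLeftEigenvector hn hC hirr
  have hpos := dominantLeftEigenvector_pos hn hC hirr
  set c := dominantLeftEigenvector C
  obtain ⟨h0, h1⟩ := Matrix.mem_rowStochastic_iff_sum.1 hC.rowStochastic
  simp only [HasStarTopology, not_exists, not_forall, not_or] at hstar
  obtain ⟨j, k, hjk, hji, hki⟩ := hstar i
  have hCji : C j i < 1 := by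
    have : C j k + C j i ≤ ∑ l, C j l := by
      rw [← sum_pair hki]
      exact sum_le_sum_of_subset_of_nonneg (subset_univ _) fun l _ _ => h0 j l
    linarith [h1 j]
  have hle1 : ∀ l, C l i ≤ 1 := fun l =>
    (single_le_sum (fun m _ => h0 l m) (mem_univ i)).trans_eq (h1 l)
  have hsum := sum_erase_add univ c (mem_univ i)
  calc c i = ∑ l, c l * C l i := (congrFun hv i).symm
    _ = ∑ l ∈ univ.erase i, c l * C l i := by
        rw [← sum_erase_add univ _ (mem_univ i), hC.diag_zero, mul_zero, add_zero]
    _ < ∑ l ∈ univ.erase i, c l :=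
        sum_lt_sum (fun l _ => mul_le_of_le_one_right (hpos l).le (hle1 l))
          ⟨j, mem_erase.2 ⟨hji, mem_univ j⟩, mul_lt_of_lt_one_right (hpos j) hCji⟩
    _ = 1 - c i := by linarith

/-- The unnormalised entries of `dfMap C x`. -/
noncomputable def dfWeight (C : Matrix (Fin n) (Fin n) ℝ) (x : Fin n → ℝ) (i : Fin n) : ℝ :=
  dominantLeftEigenvector C i / (1 - x i)

theorem dfMap_single (C : Matrix (Fin n) (Fin n) ℝ) (i : Fin n) :
    dfMap C (Pi.single i 1) = Pi.single i 1 :=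
  if_pos ⟨i, rfl⟩

theorem dfMap_apply {x : Fin n → ℝ} (hx : x ∈ simplexMinusVertices n) (i : Fin n) :
    dfMap C x i = dfWeight C x i / ∑ k, dfWeight C x k := by
  rw [dfMap, if_neg hx.2, normaliser, one_div_mul_eq_div]
  rfl

theorem dfWeight_pos (hn : 1 ≤ n) (hC : IsRelativeInteraction C) (hirr : C.IsIrreducible)
    {x : Fin n → ℝ} (hx : x ∈ simplexMinusVertices n) (i : Fin n) : 0 < dfWeight C x i :=
  div_pos (dominantLeftEigenvector_pos hn hC hirr i)
    (sub_pos.2 (lt_one_of_mem_simplexMinusVertices hx i))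

theorem sum_dfWeight_pos (hn : 1 ≤ n) (hC : IsRelativeInteraction C) (hirr : C.IsIrreducible)
    {x : Fin n → ℝ} (hx : x ∈ simplexMinusVertices n) : 0 < ∑ i, dfWeight C x i :=
  sum_pos (fun i _ => dfWeight_pos hn hC hirr hx i) ⟨⟨0, hn⟩, mem_univ _⟩

theorem normaliser_pos (hn : 1 ≤ n) (hC : IsRelativeInteraction C) (hirr : C.IsIrreducible)
    {x : Fin n → ℝ} (hx : x ∈ simplexMinusVertices n) : 0 < normaliser C x :=
  one_div_pos.2 (sum_dfWeight_pos hn hC hirr hx)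

theorem dfMap_mem_simplexInterior (hn : 1 ≤ n) (hC : IsRelativeInteraction C)
    (hirr : C.IsIrreducible) {x : Fin n → ℝ} (hx : x ∈ simplexMinusVertices n) :
    dfMap C x ∈ simplexInterior n := by
  have hS := sum_dfWeight_pos hn hC hirr hx
  refine ⟨fun i => ?_, ?_⟩
  · rw [dfMap_apply hx]
    exact div_pos (dfWeight_pos hn hC hirr hx i) hS
  · simp only [dfMap_apply hx, ← sum_div, div_self hS.ne']

/-- The odds of entry `i` of `dfMap C x` are `c i / (1 - x i)` to the sum of the other weights. The
first is at most `c i / r` and the second at least `1 - c i`, so the odds are at most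
`(1 - r) / r`. -/
theorem dfMap_mem_truncatedSimplex (hn : 1 ≤ n) (hC : IsRelativeInteraction C)
    (hirr : C.IsIrreducible) {r : ℝ} (hr : 0 < r)
    (hcr : ∀ i, dominantLeftEigenvector C i ≤ (1 - r) * (1 - dominantLeftEigenvector C i))
    {x : Fin n → ℝ} (hx : x ∈ truncatedSimplex n r) : dfMap C x ∈ truncatedSimplex n r := by
  have hx' := truncatedSimplex_subset hr hx
  have hint := dfMap_mem_simplexInterior hn hC hirr hx'
  refine ⟨⟨fun i => (hint.1 i).le, hint.2⟩, fun i => ?_⟩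
  have hpos := dominantLeftEigenvector_pos hn hC hirr
  have hsum := (isDominantLeftEigenvector_dominantLeftEigenvector hn hC hirr).2
  rw [dfMap_apply hx', div_le_iff₀ (sum_dfWeight_pos hn hC hirr hx'),
    ← sum_erase_add univ _ (mem_univ i)]
  set c := dominantLeftEigenvector C
  have hlt := lt_one_of_mem_simplexMinusVertices hx'
  have h1 : r * dfWeight C x i ≤ c i := by
    have h : dfWeight C x i * (1 - x i) = c i := div_mul_cancel₀ _ (sub_pos.2 (hlt i)).ne'
    rw [← h, mul_comm]
    exact mul_le_mul_of_nonneg_left (by linarith [hx.2 i]) (dfWeight_pos hn hC hirr hx' i).le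
  have h2 : 1 - c i ≤ ∑ k ∈ univ.erase i, dfWeight C x k := by
    have h : ∑ k ∈ univ.erase i, c k = 1 - c i := by
      linarith [sum_erase_add univ c (mem_univ i)]
    rw [← h]
    refine sum_le_sum fun k _ => le_div_self (hpos k).le (sub_pos.2 (hlt k)) ?_
    linarith [hx.1.1 k]
  have hr1 : 0 ≤ 1 - r := (hx.1.1 i).trans (hx.2 i)
  linarith [hcr i, mul_le_mul_of_nonneg_left h2 hr1]

/-- The coordinates `log (1 - x i)` turn `dfMap C` into the map of `sum_abs_negLogCompl_lt`: up to
a constant shift, `log (dfWeight C x i)` is `-log (1 - x i)`. -/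
theorem logDist_dfMap_lt (hn : 3 ≤ n) (hC : IsRelativeInteraction C) (hirr : C.IsIrreducible)
    {x y : Fin n → ℝ} (hx : x ∈ simplexMinusVertices n) (hy : y ∈ simplexMinusVertices n)
    (hxy : x ≠ y) : logDist (dfMap C x) (dfMap C y) < logDist x y := by
  have hn1 : 1 ≤ n := by omega
  have hpos := dominantLeftEigenvector_pos hn1 hC hirr
  have hlog : ∀ {z}, z ∈ simplexMinusVertices n → ∀ i,
      Real.log (1 - dfMap C z i) = -negLogCompl (dfWeight C z) i := by
    intro z hz i
    have hS := sum_dfWeight_pos hn1 hC hirr hz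
    have hlt := lt_one_of_mem_simplexMinusVertices
      (simplexInterior_subset (by omega) (dfMap_mem_simplexInterior hn1 hC hirr hz)) i
    rw [dfMap_apply hz, div_lt_one hS] at hlt
    rw [dfMap_apply hz, one_sub_div hS.ne', Real.log_div (sub_pos.2 hlt).ne' hS.ne', negLogCompl]
    ring
  have hw : ∀ {z}, z ∈ simplexMinusVertices n → ∀ i,
      Real.log (dfWeight C z i) = Real.log (dominantLeftEigenvector C i) - Real.log (1 - z i) :=
    fun hz i => Real.log_div (hpos i).ne'
      (sub_pos.2 (lt_one_of_mem_simplexMinusVertices hz i)).ne'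
  have hne : dfWeight C x ≠ dfWeight C y := by
    obtain ⟨i, hi⟩ := Function.ne_iff.1 hxy
    refine fun h => hi ?_
    have hi' := congrFun h i
    rw [dfWeight, dfWeight, div_eq_div_iff
      (sub_pos.2 (lt_one_of_mem_simplexMinusVertices hx i)).ne'
      (sub_pos.2 (lt_one_of_mem_simplexMinusVertices hy i)).ne'] at hi'
    linarith [mul_left_cancel₀ (hpos i).ne' hi']
  have h := sum_abs_negLogCompl_lt (by simpa using hn) (dfWeight_pos hn1 hC hirr hx)
    (dfWeight_pos hn1 hC hirr hy) hne
  simp only [logDist, hlog hx, hlog hy]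
  simp only [hw hx, hw hy, sub_sub_sub_cancel_left] at h
  simp only [neg_sub_neg, abs_sub_comm (negLogCompl (dfWeight C y) _)]
  simpa only [abs_sub_comm (Real.log (1 - y _))] using h

/-! ### Continuity at the vertices -/

/-- The weights of `dfMap C x` multiplied by `1 - x j`, in a form that stays meaningful at the
vertex `x j = 1`. -/
noncomputable def vertexWeight (C : Matrix (Fin n) (Fin n) ℝ) (j : Fin n) (x : Fin n → ℝ)
    (i : Fin n) : ℝ :=
  if i = j then dominantLeftEigenvector C i
  else dominantLeftEigenvector C i * (1 - x j) / (1 - x i)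

theorem lt_one_of_pos_of_ne {x : Fin n → ℝ} (hx : x ∈ stdSimplex ℝ (Fin n)) {i j : Fin n}
    (hj : 0 < x j) (hij : i ≠ j) : x i < 1 := by
  have : x i + x j ≤ ∑ k, x k := by
    rw [← sum_pair hij]
    exact sum_le_sum_of_subset_of_nonneg (subset_univ _) fun k _ _ => hx.1 k
  linarith [hx.2]

theorem sum_vertexWeight_pos (hn : 1 ≤ n) (hC : IsRelativeInteraction C) (hirr : C.IsIrreducible)
    {x : Fin n → ℝ} (hx : x ∈ stdSimplex ℝ (Fin n)) {j : Fin n} (hj : 0 < x j) :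
    0 < ∑ i, vertexWeight C j x i := by
  have hpos := dominantLeftEigenvector_pos hn hC hirr
  have hxj : x j ≤ 1 := hx.2 ▸ single_le_sum (fun k _ => hx.1 k) (mem_univ j)
  refine sum_pos' (fun i _ => ?_) ⟨j, mem_univ j, by simpa [vertexWeight] using hpos j⟩
  unfold vertexWeight
  split_ifs with h
  · exact (hpos i).le
  · exact div_nonneg (mul_nonneg (hpos i).le (sub_nonneg.2 hxj))
      (sub_nonneg.2 (lt_one_of_pos_of_ne hx hj h).le)

theorem dfMap_eq_vertexWeight (hn : 1 ≤ n) (hC : IsRelativeInteraction C)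
    (hirr : C.IsIrreducible) {x : Fin n → ℝ} (hx : x ∈ stdSimplex ℝ (Fin n)) {j : Fin n}
    (hj : 0 < x j) (i : Fin n) :
    dfMap C x i = vertexWeight C j x i / ∑ k, vertexWeight C j x k := by
  by_cases hv : x ∈ Set.range fun i : Fin n => (Pi.single i 1 : Fin n → ℝ)
  · obtain ⟨l, rfl⟩ := hv
    obtain rfl : j = l := by
      by_contra h
      simp [h] at hj
    have hw : vertexWeight C j (Pi.single j 1) =
        Pi.single j (dominantLeftEigenvector C j) := by
      funext k
      rcases eq_or_ne k j with rfl | hk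
      · simp [vertexWeight]
      · simp [vertexWeight, hk]
    have hpos := dominantLeftEigenvector_pos hn hC hirr j
    simp only [dfMap_single, hw, sum_pi_single', mem_univ, if_true]
    rcases eq_or_ne i j with rfl | hi
    · simp [hpos.ne']
    · simp [hi]
  · have hx' : x ∈ simplexMinusVertices n := ⟨hx, hv⟩
    have h1 : ∀ k, 1 - x k ≠ 0 := fun k =>
      (sub_pos.2 (lt_one_of_mem_simplexMinusVertices hx' k)).ne'
    have hw : ∀ k, vertexWeight C j x k = (1 - x j) * dfWeight C x k := by
      intro k
      unfold vertexWeight dfWeight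
      split_ifs with h
      · rw [h, mul_div_cancel₀ _ (h1 j)]
      · ring
    simp only [hw, ← mul_sum, mul_div_mul_left _ _ (h1 j), dfMap_apply hx']

theorem continuousOn_dfMap (hn : 1 ≤ n) (hC : IsRelativeInteraction C) (hirr : C.IsIrreducible) :
    ContinuousOn (dfMap C) (stdSimplex ℝ (Fin n)) := by
  intro x hx
  obtain ⟨j, -, hj⟩ := exists_ne_zero_of_sum_ne_zero (hx.2.trans_ne one_ne_zero)
  have hj0 : 0 < x j := lt_of_le_of_ne (hx.1 j) (Ne.symm hj)
  have hcont : ∀ i, ContinuousAt (fun y => vertexWeight C j y i) x := by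
    intro i
    unfold vertexWeight
    split_ifs with h
    · exact continuousAt_const
    · have hsub : ∀ k, ContinuousAt (fun y : Fin n → ℝ => 1 - y k) x := fun k =>
        continuousAt_const.sub (continuous_apply k).continuousAt
      exact (continuousAt_const.mul (hsub j)).div (hsub i)
        (sub_pos.2 (lt_one_of_pos_of_ne hx hj0 h)).ne'
  have hform : ContinuousAt (fun y i => vertexWeight C j y i / ∑ k, vertexWeight C j y k) x :=
    continuousAt_pi.2 fun i => (hcont i).div (tendsto_finsetSum _ fun k _ => hcont k)
      (sum_vertexWeight_pos hn hC hirr hx hj0).ne'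
  refine hform.continuousWithinAt.congr_of_eventuallyEq_of_mem ?_ hx
  have hopen : ∀ᶠ y in nhdsWithin x (stdSimplex ℝ (Fin n)), 0 < y j :=
    nhdsWithin_le_nhds ((continuous_apply j).continuousAt.eventually (lt_mem_nhds hj0))
  filter_upwards [hopen, self_mem_nhdsWithin] with y hy hy'
  exact funext fun i => dfMap_eq_vertexWeight hn hC hirr hy' hy i

theorem mapsTo_dfMap (hn : 2 ≤ n) (hC : IsRelativeInteraction C) (hirr : C.IsIrreducible) :
    Set.MapsTo (dfMap C) (stdSimplex ℝ (Fin n)) (stdSimplex ℝ (Fin n)) := by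
  intro x hx
  by_cases hv : x ∈ Set.range fun i : Fin n => (Pi.single i 1 : Fin n → ℝ)
  · rwa [dfMap, if_pos hv]
  · exact (simplexInterior_subset hn
      (dfMap_mem_simplexInterior (by omega) hC hirr ⟨hx, hv⟩)).1

end DFMap

/-! ### Cyclic compositions -/

section Composition

variable {n M : ℕ} {C : Fin M → Matrix (Fin n) (Fin n) ℝ} {p : Fin M}

theorem partialComp_succ_apply (C : Fin M → Matrix (Fin n) (Fin n) ℝ) (p : Fin M) (k : ℕ)
    (x : Fin n → ℝ) :
    partialComp C p (k + 1) x = dfMap (C (cyclicIndex p k)) (partialComp C p k x) :=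
  rfl

theorem partialComp_single (C : Fin M → Matrix (Fin n) (Fin n) ℝ) (p : Fin M) (k : ℕ)
    (i : Fin n) : partialComp C p k (Pi.single i 1) = Pi.single i 1 := by
  induction k with
  | zero => rfl
  | succ k ih => rw [partialComp_succ_apply, ih, dfMap_single]

theorem mapsTo_partialComp {s : Set (Fin n → ℝ)} (h : ∀ q, Set.MapsTo (dfMap (C q)) s s)
    (k : ℕ) : Set.MapsTo (partialComp C p k) s s := by
  induction k with
  | zero => exact Set.mapsTo_id s
  | succ k ih => exact (h _).comp ih

theorem continuousOn_partialComp {s : Set (Fin n → ℝ)} (h : ∀ q, Set.MapsTo (dfMap (C q)) s s)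
    (hc : ∀ q, ContinuousOn (dfMap (C q)) s) (k : ℕ) : ContinuousOn (partialComp C p k) s := by
  induction k with
  | zero => exact continuousOn_id
  | succ k ih => exact (hc _).comp ih (mapsTo_partialComp h k)

theorem mapsTo_dfMap_simplexMinusVertices (hn : 2 ≤ n) {C : Matrix (Fin n) (Fin n) ℝ}
    (hC : IsRelativeInteraction C) (hirr : C.IsIrreducible) :
    Set.MapsTo (dfMap C) (simplexMinusVertices n) (simplexMinusVertices n) :=
  fun _ hx => simplexInterior_subset hn (dfMap_mem_simplexInterior (by omega) hC hirr hx)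

theorem logDist_partialComp_lt (hn : 3 ≤ n) (hC : ∀ q, IsRelativeInteraction (C q))
    (hirr : ∀ q, (C q).IsIrreducible) {x y : Fin n → ℝ} (hx : x ∈ simplexMinusVertices n)
    (hy : y ∈ simplexMinusVertices n) (hxy : x ≠ y) {k : ℕ} (hk : 1 ≤ k) :
    logDist (partialComp C p k x) (partialComp C p k y) < logDist x y := by
  induction k, hk using Nat.le_induction with
  | base => exact logDist_dfMap_lt hn (hC _) (hirr _) hx hy hxy
  | succ k _ ih =>
    have hmaps := mapsTo_partialComp (C := C) (p := p)
      (fun q => mapsTo_dfMap_simplexMinusVertices (by omega) (hC q) (hirr q)) k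
    rw [partialComp_succ_apply, partialComp_succ_apply]
    by_cases h : partialComp C p k x = partialComp C p k y
    · rw [h, logDist_self]
      exact (logDist_nonneg _ _).trans_lt ih
    · exact (logDist_dfMap_lt hn (hC _) (hirr _) (hmaps hx) (hmaps hy) h).trans ih

/-- A small enough `r` satisfies `c i ≤ (1 - r) (1 - c i)` for the finitely many entries of all the
dominant left eigenvectors, since `c i < 1 - c i`. -/
theorem exists_mapsTo_truncatedSimplex (hn : 1 ≤ n) (hC : ∀ q, IsRelativeInteraction (C q))
    (hirr : ∀ q, (C q).IsIrreducible) (hstar : ∀ q, ¬ HasStarTopology (C q)) :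
    ∃ r, 0 < r ∧ r ≤ 1 / 2 ∧
      ∀ q, Set.MapsTo (dfMap (C q)) (truncatedSimplex n r) (truncatedSimplex n r) := by
  have hev : ∀ᶠ r : ℝ in nhdsWithin 0 (Set.Ioi 0), ∀ q i, dominantLeftEigenvector (C q) i ≤
      (1 - r) * (1 - dominantLeftEigenvector (C q) i) := by
    simp only [Filter.eventually_all]
    intro q i
    have hc : ContinuousAt (fun r : ℝ => (1 - r) * (1 - dominantLeftEigenvector (C q) i)) 0 := by
      fun_prop
    have h := hc.eventually (lt_mem_nhds (a := dominantLeftEigenvector (C q) i) (by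
      simpa using dominantLeftEigenvector_lt_one_sub hn (hC q) (hirr q) (hstar q) i))
    exact nhdsWithin_le_nhds (h.mono fun r hr => hr.le)
  obtain ⟨r, hr, hr0, hr1⟩ :=
    (hev.and (Ioc_mem_nhdsGT (show (0 : ℝ) < 1 / 2 by norm_num))).exists
  exact ⟨r, hr0, hr1, fun q x hx => dfMap_mem_truncatedSimplex hn (hC q) (hirr q) hr0 (hr q) hx⟩

/-- A minimiser of `logDist x (G x)` over an invariant truncated simplex is a fixed point of the
strict contraction `G`. -/
theorem exists_partialComp_eq (hn : 3 ≤ n) (hC : ∀ q, IsRelativeInteraction (C q))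
    (hirr : ∀ q, (C q).IsIrreducible) (hstar : ∀ q, ¬ HasStarTopology (C q)) {k : ℕ}
    (hk : 1 ≤ k) : ∃ y ∈ simplexMinusVertices n, partialComp C p k y = y := by
  obtain ⟨r, hr0, hr1, hmaps⟩ := exists_mapsTo_truncatedSimplex (by omega) hC hirr hstar
  have hsub := truncatedSimplex_subset (n := n) hr0
  have hG := mapsTo_partialComp (p := p) hmaps k
  have hcont : ContinuousOn (partialComp C p k) (truncatedSimplex n r) :=
    (continuousOn_partialComp (fun q => mapsTo_dfMap (by omega) (hC q) (hirr q))
      (fun q => continuousOn_dfMap (by omega) (hC q) (hirr q)) k).mono fun x hx => hx.1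
  obtain ⟨y, hy, hmin⟩ := (isCompact_truncatedSimplex n r).exists_isMinOn
    (truncatedSimplex_nonempty (by omega) hr1)
    (continuousOn_logDist continuousOn_id hcont
      (fun x hx => lt_one_of_mem_simplexMinusVertices (hsub hx))
      (fun x hx => lt_one_of_mem_simplexMinusVertices (hsub (hG hx))))
  refine ⟨y, hsub hy, ?_⟩
  by_contra hne
  exact (hmin (hG hy)).not_gt
    (logDist_partialComp_lt hn hC hirr (hsub hy) (hsub (hG hy)) (Ne.symm hne) hk)

end Composition

end DeGrootFriedkin

theorem mainTheorem2 (n M : ℕ) (hn : 3 ≤ n) (hM : 3 ≤ M)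
    (C : Fin M → Matrix (Fin n) (Fin n) ℝ)
    (hC : ∀ p, DeGrootFriedkin.IsRelativeInteraction (C p))
    (hirr : ∀ p, (C p).IsIrreducible)
    (hstar : ∀ p, ¬ DeGrootFriedkin.HasStarTopology (C p))
    (p : Fin M) :
    (∀ y ∈ DeGrootFriedkin.simplexMinusVertices n, ∀ k < M,
      DeGrootFriedkin.partialComp C p k y ∈ DeGrootFriedkin.simplexMinusVertices n ∧
      0 < DeGrootFriedkin.normaliser (C (DeGrootFriedkin.cyclicIndex p k))
        (DeGrootFriedkin.partialComp C p k y)) ∧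
    (∀ i : Fin n, DeGrootFriedkin.cyclicComp C p (Pi.single i 1) = Pi.single i 1) ∧
    (Set.MapsTo (DeGrootFriedkin.cyclicComp C p) (stdSimplex ℝ (Fin n)) (stdSimplex ℝ (Fin n)) ∧
      ContinuousOn (DeGrootFriedkin.cyclicComp C p) (stdSimplex ℝ (Fin n))) ∧
    (∃ y ∈ DeGrootFriedkin.simplexInterior n, DeGrootFriedkin.cyclicComp C p y = y) := by
  obtain ⟨m, rfl⟩ : ∃ m, M = m + 1 := ⟨M - 1, by omega⟩
  have hmaps := fun q => DeGrootFriedkin.mapsTo_dfMap (by omega) (hC q) (hirr q)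
  have hmaps' := fun q =>
    DeGrootFriedkin.mapsTo_dfMap_simplexMinusVertices (by omega) (hC q) (hirr q)
  refine ⟨fun y hy k _ => ?_, DeGrootFriedkin.partialComp_single C p (m + 1),
    ⟨DeGrootFriedkin.mapsTo_partialComp hmaps _, DeGrootFriedkin.continuousOn_partialComp hmaps
      (fun q => DeGrootFriedkin.continuousOn_dfMap (by omega) (hC q) (hirr q)) _⟩, ?_⟩
  · have hk := DeGrootFriedkin.mapsTo_partialComp (p := p) hmaps' k hy
    exact ⟨hk, DeGrootFriedkin.normaliser_pos (by omega) (hC _) (hirr _) hk⟩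
  · obtain ⟨y, hy, hfix⟩ := DeGrootFriedkin.exists_partialComp_eq (p := p) hn hC hirr hstar
      (k := m + 1) (by omega)
    refine ⟨y, ?_, hfix⟩
    -- The last map of the composition lands in the interior, hence so does its fixed point.
    rw [← hfix]
    exact DeGrootFriedkin.dfMap_mem_simplexInterior (by omega) (hC _) (hirr _)
      (DeGrootFriedkin.mapsTo_partialComp hmaps' m hy)
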